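/- Let $n\ge 2$ and let $(W,S)$ be the Coxeter system of type $\widetilde{\mathsf A}_n$: $S=\{s_0,\dots,s_n\}$ with indices read modulo $n+1$, $m_{s_is_{i+1}}=3$ and $m_{s_is_j}=2$ for distinct non-adjacent $i,j$. Representations are over $\mathbb C$ and may be infinite dimensional. A representation $V$ of $W$ is an *A1-representation* if there is no $v\in V\setminus\{0\}$ with $r\cdot v=t\cdot v=-v$ for some $r\ne t$ in $S$ (with $m_{rt}<\infty$). It is an *IR-representation* if it has a basis $\{\alpha_s\}_{s\in S}$ such that every $s\in S$ fixes pointwise a subspace of codimension $1$ and $s\cdot\alpha_s=-\alpha_s$. A datum consists of integers $1\le k_{rt}=k_{tr}\le m_{rt}/2$ and numbers $a_r^t\in\mathbb C^\times$ for $r\ne t$ in $S$. It defines the representation on $\bigoplus_{s}\mathbb C\alpha_s$ with $$r\cdot\alpha_r=-\alpha_r,\qquad r\cdot\alpha_t=\alpha_t+2\frac{a_r^t}{a_t^r}\cos\frac{k_{rt}\pi}{m_{rt}}\,\alpha_r\quad(t\ne r).$$ Its matrix $A$ has diagonal entries $1$ and $(r,t)$ entries $-\frac{a_r^t}{a_t^r}\cos\frac{k_{rt}\pi}{m_{rt}}$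 for $r\neq t$, and its monodromy around the circuit $(s_0,s_1,\dots,s_n,s_0)$ is $\prod_{i=0}^{n} a_{s_{i+1}}^{s_i}/a_{s_i}^{s_{i+1}}$. Let $V_{\mathrm{geom}}$ be the geometric representation (all $k_{rt}=1$, all $a_r^t=1$), and for $x\in\mathbb C^\times$ let $V_x$ be the representation with all $k_{rt}=1$, $a_{s_0}^{s_n}=x$ and all other $a_r^t=1$. Then: 1. $V_{\mathrm{geom}}$ has exactly one subrepresentation with irreducible quotient, and every irreducible A1-representation of $W$ on which $W$ acts nontrivially is isomorphic either to this simple quotient of $V_{\mathrm{geom}}$ or to $V_x$ for some $x\in\mathbb C\setminus\{0,1\}$. 2. Every IR-representation $V$ of $W$ is defined, in some basis, by a datum; the monodromy of such a datum depends only on $V$ and is a nonzero number, called the monodromy of $V$. For every $x\in\mathbb C^\times$, $V_x$ is an IR-representation with monodromy $x$, and an IR-representation is isomorphic to $V_x$ if and only if its monodromy is $x$. 3. For every $x\in\mathbb C^\times$ the matrix $A$ of $V_x$ satisfies $\det A=(2-x-x^{-1})/2^{n+1}$, and $V_x$ is irreducible if and only if $x\ne 1$. -/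

import Mathlib

universe u v

noncomputable section

namespace CoxeterIR

open Matrix

section Representations

variable {B W : Type*} [Group W] {M : CoxeterMatrix B}
  {V : Type*} [AddCommGroup V] [Module ℂ V]

/-- `A1`-representations: no nonzero vector is negated by two distinct simple reflections `r`, `t`
with `m_{rt} < ∞` (in Mathlib's convention the value `0` of a Coxeter matrix stands for `∞`). -/
def IsA1 (cs : CoxeterSystem M W) (ρ : Representation ℂ W V) : Prop :=
  ∀ r t : B, r ≠ t → M r t ≠ 0 →
    ∀ v : V, ρ (cs.simple r) v = -v → ρ (cs.simple t) v = -v → v = 0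

/-- `IR`-representations (independent reflections): there is a basis `α_s` indexed by the simple
reflections, and every `s` fixes pointwise a subspace of codimension one and negates `α_s`. -/
def IsIR (cs : CoxeterSystem M W) (ρ : Representation ℂ W V) : Prop :=
  ∃ α : Module.Basis B ℂ V, ∀ s : B,
    (∃ H : Submodule ℂ V, Module.finrank ℂ (V ⧸ H) = 1 ∧ ∀ v ∈ H, ρ (cs.simple s) v = v) ∧
    ρ (cs.simple s) (α s) = -α s

/-- The quotient of a representation by a subrepresentation. -/
def quotientRep (ρ : Representation ℂ W V) (U : Subrepresentation ρ) :
    Representation ℂ W (V ⧸ U.toSubmodule) :=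
  ρ.quotient U.toSubmodule fun g _ hv => U.apply_mem_toSubmodule g hv

end Representations

/-- The datum `(k_{rt}, a_r^t)_{r ≠ t}` for a Coxeter matrix with finite entries; `a r t` stands
for `a_r^t`. Diagonal values are never used. -/
structure IRDatum {B : Type*} (M : CoxeterMatrix B) where
  k : B → B → ℕ
  a : B → B → ℂ
  one_le_k : ∀ r t, r ≠ t → 1 ≤ k r t
  two_mul_k_le : ∀ r t, r ≠ t → 2 * k r t ≤ M r t
  k_symm : ∀ r t, r ≠ t → k r t = k t r
  a_ne_zero : ∀ r t, r ≠ t → a r t ≠ 0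

namespace IRDatum

variable {B : Type*} [DecidableEq B] {M : CoxeterMatrix B} (D : IRDatum M)

/-- The angle `k_{rt} π / m_{rt}`. -/
def angle (r t : B) : ℝ := D.k r t * Real.pi / M r t

/-- The representation `ρ` is given by the datum `D`: in some basis `(α_s)`,
`r α_r = -α_r` and `r α_t = α_t + 2 (a_r^t / a_t^r) cos (k_{rt} π / m_{rt}) α_r` for `t ≠ r`. -/
def Defines {W V : Type*} [Group W] [AddCommGroup V] [Module ℂ V]
    (cs : CoxeterSystem M W) (ρ : Representation ℂ W V) : Prop :=
  ∃ α : Module.Basis B ℂ V, ∀ r : B,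
    ρ (cs.simple r) (α r) = -α r ∧
    ∀ t : B, t ≠ r → ρ (cs.simple r) (α t) =
      α t + (2 * (D.a r t / D.a t r) * (Real.cos (D.angle r t) : ℂ)) • α r

/-- The matrix `A` of the datum: diagonal entries `1`, and the `(r, t)` entry for `r ≠ t` is
`-(a_r^t / a_t^r) cos (k_{rt} π / m_{rt})`. -/
def matrixA : Matrix B B ℂ :=
  Matrix.of fun r t =>
    if r = t then 1 else -(D.a r t / D.a t r) * (Real.cos (D.angle r t) : ℂ)

variable [Fintype B]

/-- The reflection attached to `r`, acting on `⨁_s ℂ α_s = (B → ℂ)` (with `α_s = Pi.single s 1`):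
`v ↦ v - 2 (A v)_r α_r`. -/
def refl (r : B) : Module.End ℂ (B → ℂ) :=
  LinearMap.id -
    (2 : ℂ) • (LinearMap.single ℂ (fun _ : B => ℂ) r ∘ₗ LinearMap.proj r ∘ₗ D.matrixA.mulVecLin)

theorem refl_apply (r : B) (v : B → ℂ) :
    D.refl r v = v - (2 * (D.matrixA *ᵥ v) r) • Pi.single r 1 := by
  ext s
  by_cases h : s = r
  · subst h; simp [refl]
  · simp [refl, h]

theorem refl_single_self (r : B) : D.refl r (Pi.single r 1) = -Pi.single r 1 := by
  rw [refl_apply]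
  have : (D.matrixA *ᵥ Pi.single r 1) r = 1 := by simp [matrixA]
  rw [this]
  module

theorem refl_single_of_ne {r t : B} (h : t ≠ r) :
    D.refl r (Pi.single t 1) = Pi.single t 1 +
      (2 * (D.a r t / D.a t r) * (Real.cos (D.angle r t) : ℂ)) • Pi.single r 1 := by
  rw [refl_apply]
  have : (D.matrixA *ᵥ Pi.single t 1) r = -(D.a r t / D.a t r) * (Real.cos (D.angle r t) : ℂ) := by
    simp [matrixA, h.symm]
  rw [this]
  module

theorem refl_mul_sub (r t : B) (v : B → ℂ) :
    ∃ x y : ℂ, (D.refl r * D.refl t) v - v = x • Pi.single r 1 + y • Pi.single t 1 := by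
  refine ⟨-(2 * (D.matrixA *ᵥ (D.refl t v)) r), -(2 * (D.matrixA *ᵥ v) t), ?_⟩
  rw [Module.End.mul_apply, refl_apply D r (D.refl t v), refl_apply D t v]
  module

theorem refl_mul_quadratic {r t : B} (h : r ≠ t) (x y : ℂ) :
    let T := D.refl r * D.refl t
    let w : B → ℂ := x • Pi.single r 1 + y • Pi.single t 1
    T (T w) - (2 * (Real.cos (2 * D.angle r t) : ℂ)) • T w + w = 0 := by
  intro T w
  set p : ℂ := 2 * (D.a r t / D.a t r) * (Real.cos (D.angle r t) : ℂ) with hp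
  set q : ℂ := 2 * (D.a t r / D.a r t) * (Real.cos (D.angle t r) : ℂ) with hq
  have hang : D.angle t r = D.angle r t := by
    simp [angle, M.symmetric t r, D.k_symm t r h.symm]
  have hpq : p * q - 2 = 2 * (Real.cos (2 * D.angle r t) : ℂ) := by
    have h1 := D.a_ne_zero r t h
    have h2 := D.a_ne_zero t r h.symm
    rw [hp, hq, hang, Real.cos_two_mul]
    push_cast
    field_simp
  have hr : T (Pi.single r 1) = (p * q - 1) • Pi.single r 1 + q • Pi.single t 1 := by
    simp only [T, Module.End.mul_apply]
    rw [refl_single_of_ne D h, ← hq, map_add, map_smul, refl_single_self,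
      refl_single_of_ne D h.symm, ← hp]
    module
  have ht : T (Pi.single t 1) = (-p) • Pi.single r 1 - Pi.single t 1 := by
    simp only [T, Module.End.mul_apply]
    rw [refl_single_self, map_neg, refl_single_of_ne D h.symm, ← hp]
    module
  rw [← hpq]
  simp only [w, map_add, map_smul, hr, ht, map_sub]
  module

/-- The reflections of a datum satisfy the Coxeter relations. -/
theorem isLiftable : M.IsLiftable D.refl := by
  intro r t
  rcases eq_or_ne r t with rfl | h
  · rw [M.diagonal, pow_one]
    refine LinearMap.ext fun v => ?_
    rw [Module.End.mul_apply, refl_apply D r v, map_sub, map_smul, refl_single_self,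
      refl_apply D r v, Module.End.one_apply]
    module
  set T := D.refl r * D.refl t with hT
  set θ := D.angle r t with hθ
  have hk := D.one_le_k r t h
  have hkm := D.two_mul_k_le r t h
  have hm : 0 < M r t := by omega
  have hm' : (M r t : ℝ) ≠ 0 := by positivity
  have key : ∀ v, T (T (T v - v)) - (2 * (Real.cos (2 * θ) : ℂ)) • T (T v - v) + (T v - v) = 0 := by
    intro v
    obtain ⟨x, y, hxy⟩ := D.refl_mul_sub r t v
    rw [hxy]
    exact D.refl_mul_quadratic h x y
  rcases eq_or_lt_of_le hkm with hkm | hkm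
  · have hc : θ = Real.pi / 2 := by
      have : (M r t : ℝ) = 2 * D.k r t := by exact_mod_cast hkm.symm
      have hk0 : (D.k r t : ℝ) ≠ 0 := by positivity
      rw [hθ, angle, this]
      field_simp
    have hpl : ∀ x y : ℂ, T (x • Pi.single r 1 + y • Pi.single t 1) =
        -(x • Pi.single r 1 + y • Pi.single t 1) := by
      intro x y
      have hang : D.angle t r = Real.pi / 2 := by
        rw [← hc, hθ]; simp [angle, M.symmetric t r, D.k_symm t r h.symm]
      rw [hT, Module.End.mul_apply]
      simp only [map_add, map_smul, refl_single_self, refl_single_of_ne D h,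
        refl_single_of_ne D h.symm, hang, ← hθ, hc, Real.cos_pi_div_two, map_neg]
      simp
      abel
    have hT2 : T ^ 2 = 1 := by
      refine LinearMap.ext fun v => ?_
      obtain ⟨x, y, hxy⟩ := D.refl_mul_sub r t v
      have h1 := hpl x y
      rw [← hxy, map_sub] at h1
      rw [pow_two, Module.End.mul_apply, Module.End.one_apply]
      have h2 : T (T v) - T v = -(T v - v) := h1
      linear_combination (exp := 1) h2
    rw [← hkm, pow_mul, hT2, one_pow]
  · set ζ : ℂ := Complex.exp ((2 * θ : ℝ) * Complex.I) with hζ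
    have hζ0 : ζ ≠ 0 := Complex.exp_ne_zero _
    have hζm : ζ ^ M r t = 1 := by
      rw [hζ, ← Complex.exp_nat_mul, Complex.exp_eq_one_iff]
      refine ⟨D.k r t, ?_⟩
      have : (M r t : ℂ) ≠ 0 := by exact_mod_cast hm.ne'
      rw [hθ, angle]
      push_cast
      field_simp
    have hsum : ζ + ζ⁻¹ = 2 * (Real.cos (2 * θ) : ℂ) := by
      rw [hζ, ← Complex.exp_neg, Complex.ofReal_cos, Complex.two_cos, neg_mul]
    have hpos : 0 < 2 * θ := by
      have : (0 : ℝ) < D.k r t := by exact_mod_cast hk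
      rw [hθ, angle]; positivity
    have hlt : 2 * θ < Real.pi := by
      have h3 : (2 * D.k r t : ℝ) < M r t := by exact_mod_cast hkm
      have h4 : (0 : ℝ) < M r t := by exact_mod_cast hm
      rw [hθ, angle, ← mul_div_assoc, div_lt_iff₀ h4]
      nlinarith [Real.pi_pos]
    have him : ζ.im ≠ 0 := by
      rw [hζ, Complex.exp_ofReal_mul_I_im]
      exact (Real.sin_pos_of_pos_of_lt_pi hpos hlt).ne'
    have hne1 : ζ ≠ 1 := fun e => him (by simp [e])
    have hne2 : ζ ≠ ζ⁻¹ := by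
      intro e
      have h5 : ζ * ζ = 1 := by
        nth_rewrite 2 [e]; exact mul_inv_cancel₀ hζ0
      rcases mul_self_eq_one_iff.mp h5 with e | e <;> exact him (by simp [e])
    have hne3 : ζ⁻¹ ≠ 1 := fun e => hne1 (inv_eq_one.mp e)
    have hcop : ∀ {a b : ℂ}, a ≠ b →
        IsCoprime (Polynomial.X - Polynomial.C a) (Polynomial.X - Polynomial.C b) := fun hab =>
      Polynomial.isCoprime_X_sub_C_of_isUnit_sub (sub_ne_zero.mpr hab).isUnit
    have hroot : ∀ {a : ℂ}, a ^ M r t = 1 →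
        (Polynomial.X - Polynomial.C a) ∣ (Polynomial.X ^ M r t - 1 : Polynomial ℂ) := fun ha =>
      Polynomial.dvd_iff_isRoot.mpr (by simp [Polynomial.IsRoot, ha])
    have hdvd : (Polynomial.X - Polynomial.C ζ) * (Polynomial.X - Polynomial.C ζ⁻¹) *
        (Polynomial.X - Polynomial.C 1) ∣ (Polynomial.X ^ M r t - 1 : Polynomial ℂ) :=
      IsCoprime.mul_dvd ((hcop hne1).mul_left (hcop hne3))
        (IsCoprime.mul_dvd (hcop hne2) (hroot hζm) (hroot (by rw [inv_pow, hζm, inv_one])))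
        (hroot (one_pow _))
    have hzero : Polynomial.aeval T ((Polynomial.X - Polynomial.C ζ) *
        (Polynomial.X - Polynomial.C ζ⁻¹) * (Polynomial.X - Polynomial.C 1)) = 0 := by
      refine LinearMap.ext fun v => ?_
      have hv := key v
      rw [← hsum] at hv
      simp only [map_mul, map_sub, Polynomial.aeval_X, Polynomial.aeval_C, Module.End.mul_apply,
        LinearMap.sub_apply, Module.algebraMap_end_apply, one_smul, LinearMap.zero_apply]
      rw [← hv]
      simp only [map_sub, map_smul]
      match_scalars <;> field_simp <;> ring
    obtain ⟨P, hP⟩ := hdvd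
    have : Polynomial.aeval T (Polynomial.X ^ M r t - 1 : Polynomial ℂ) = 0 := by
      rw [hP, map_mul, hzero, zero_mul]
    simpa [sub_eq_zero] using this

/-- The representation of `W` on `⨁_s ℂ α_s` defined by the datum `D`. -/
def rep {W : Type*} [Group W] (cs : CoxeterSystem M W) : Representation ℂ W (B → ℂ) :=
  cs.lift ⟨D.refl, D.isLiftable⟩

theorem rep_simple {W : Type*} [Group W] (cs : CoxeterSystem M W) (r : B) :
    D.rep cs (cs.simple r) = D.refl r :=
  cs.lift_apply_simple D.isLiftable r

theorem defines_rep {W : Type*} [Group W] (cs : CoxeterSystem M W) : D.Defines cs (D.rep cs) := by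
  refine ⟨Pi.basisFun ℂ B, fun r => ⟨?_, fun t h => ?_⟩⟩
  · simpa [rep_simple] using D.refl_single_self r
  · simpa [rep_simple] using D.refl_single_of_ne h

end IRDatum

/-- The datum of the geometric representation,
`s α_s = -α_s`, `s α_t = α_t + 2 cos (π / m_{st}) α_s`. -/
def geometricDatum {B : Type*} (M : CoxeterMatrix B) (hM : ∀ r t, M r t ≠ 0) : IRDatum M where
  k _ _ := 1
  a _ _ := 1
  one_le_k _ _ _ := le_rfl
  two_mul_k_le r t h := by
    have h1 := M.off_diagonal r t h
    have h2 := hM r t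
    omega
  k_symm _ _ _ := rfl
  a_ne_zero _ _ _ := one_ne_zero

section AffineA

/-- The Coxeter matrix of type `Ã_n`, for `n ≥ 2`, with simple reflections `s_0, …, s_n`; addition
in `Fin (n + 1)` is modulo `n + 1`. -/
def affineA (n : ℕ) : CoxeterMatrix (Fin (n + 1)) where
  M := Matrix.of fun i j => if i = j then 1 else if j = i + 1 ∨ i = j + 1 then 3 else 2
  isSymm := by
    refine Matrix.IsSymm.ext fun i j => ?_
    simp only [Matrix.of_apply, eq_comm (a := j) (b := i), or_comm]
  diagonal := by simp
  off_diagonal i j h := by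
    simp only [Matrix.of_apply, h, if_false]
    split_ifs <;> decide

theorem affineA_ne_zero (n : ℕ) (i j : Fin (n + 1)) : affineA n i j ≠ 0 := by
  change (if i = j then 1 else if j = i + 1 ∨ i = j + 1 then 3 else 2) ≠ 0
  split_ifs <;> decide

variable {n : ℕ} {W : Type*} [Group W]

/-- The value of the character `(r, t) ↦ a_t^r / a_r^t` of a datum on the circuit
`(s_0, s_1, …, s_n, s_0)`. -/
def monodromy (D : IRDatum (affineA n)) : ℂ :=
  ∏ i : Fin (n + 1), D.a (i + 1) i / D.a i (i + 1)

/-- The representation `ρ` is given by a datum whose monodromy is `x`. -/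
def HasMonodromy {V : Type*} [AddCommGroup V] [Module ℂ V] (cs : CoxeterSystem (affineA n) W)
    (ρ : Representation ℂ W V) (x : ℂ) : Prop :=
  ∃ D : IRDatum (affineA n), D.Defines cs ρ ∧ monodromy D = x

/-- The datum with `a_0^n = x` and all other `a_i^j` and all `k_{ij}` equal to `1`. -/
def datumX (n : ℕ) (x : ℂˣ) : IRDatum (affineA n) where
  k _ _ := 1
  a i j := if i = 0 ∧ j = Fin.last n then x else 1
  one_le_k _ _ _ := le_rfl
  two_mul_k_le r t h := by
    have h1 := (affineA n).off_diagonal r t h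
    have h2 := affineA_ne_zero n r t
    omega
  k_symm _ _ _ := rfl
  a_ne_zero i j _ := by
    split_ifs
    · exact x.ne_zero
    · exact one_ne_zero

/-- The representation `V_x` of a Coxeter group of type `Ã_n`. -/
def repX (cs : CoxeterSystem (affineA n) W) (x : ℂˣ) : Representation ℂ W (Fin (n + 1) → ℂ) :=
  (datumX n x).rep cs

/-- The geometric representation of a Coxeter group of type `Ã_n`. -/
def geometricRep (cs : CoxeterSystem (affineA n) W) :
    Representation ℂ W (Fin (n + 1) → ℂ) :=
  (geometricDatum (affineA n) (affineA_ne_zero n)).rep cs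

end AffineA

end CoxeterIR

end

noncomputable section

namespace CoxeterIR

open Matrix

section Relations

variable {B W : Type*} [Group W] {M : CoxeterMatrix B} (cs : CoxeterSystem M W)

theorem simple_commute {r t : B} (h : M r t = 2) :
    cs.simple r * cs.simple t = cs.simple t * cs.simple r := by
  have h1 := cs.simple_mul_simple_pow r t
  rw [h, pow_two, mul_eq_one_iff_eq_inv] at h1
  simpa using h1

theorem simple_braid {r t : B} (h : M r t = 3) :
    cs.simple r * cs.simple t * cs.simple r = cs.simple t * cs.simple r * cs.simple t := by
  have h1 : (cs.simple r * cs.simple t * cs.simple r) *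
      (cs.simple t * cs.simple r * cs.simple t) = 1 := by
    have h2 := cs.simple_mul_simple_pow r t
    rw [h] at h2
    rw [← h2]
    simp only [pow_succ, pow_zero, one_mul, mul_assoc]
  rw [mul_eq_one_iff_eq_inv] at h1
  simpa [mul_assoc] using h1

variable {V : Type*} [AddCommGroup V] [Module ℂ V] {ρ : Representation ℂ W V}

theorem simple_apply_simple_apply (r : B) (v : V) :
    ρ (cs.simple r) (ρ (cs.simple r) v) = v := by
  rw [← Module.End.mul_apply, ← map_mul]
  simp

theorem simple_commute_apply {r t : B} (h : M r t = 2) (v : V) :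
    ρ (cs.simple r) (ρ (cs.simple t) v) = ρ (cs.simple t) (ρ (cs.simple r) v) := by
  rw [← Module.End.mul_apply, ← Module.End.mul_apply, ← map_mul, ← map_mul, simple_commute cs h]

theorem simple_braid_apply {r t : B} (h : M r t = 3) (v : V) :
    ρ (cs.simple r) (ρ (cs.simple t) (ρ (cs.simple r) v)) =
      ρ (cs.simple t) (ρ (cs.simple r) (ρ (cs.simple t) v)) := by
  simp only [← Module.End.mul_apply, ← map_mul, simple_braid cs h, ← mul_assoc]

/-- A family of vectors on which the simple reflections act through the matrix `A`:
`r e_t = e_t - 2 A_{rt} e_r`. -/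
def IsFrame (ρ : Representation ℂ W V) (A : Matrix B B ℂ) (e : B → V) : Prop :=
  ∀ r t, ρ (cs.simple r) (e t) = e t - (2 * A r t) • e r

variable {cs}

theorem IsFrame.map {V' : Type*} [AddCommGroup V'] [Module ℂ V'] {ρ' : Representation ℂ W V'}
    {A : Matrix B B ℂ} {e : B → V} (he : IsFrame cs ρ A e) (f : ρ.IntertwiningMap ρ') :
    IsFrame cs ρ' A (fun i => f (e i)) := fun r t => by
  rw [← f.isIntertwining, he r t, map_sub, map_smul]

theorem IsFrame.eq_zero {A : Matrix B B ℂ} {α : Module.Basis B ℂ V} (hα : IsFrame cs ρ A α)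
    (hA : ∀ r, A r r = 1) {r t : B} (h : M r t = 2) : A r t = 0 := by
  have hrt : t ≠ r := by rintro rfl; simp at h
  have h1 := simple_commute_apply cs (ρ := ρ) h (α t)
  simp only [hα _ _, map_sub, map_smul, hA] at h1
  have h2 := congrArg (fun w => α.repr w r) h1
  simpa [hrt.symm] using h2

theorem IsFrame.mul_eq {A : Matrix B B ℂ} {α : Module.Basis B ℂ V} (hα : IsFrame cs ρ A α)
    (hA : ∀ r, A r r = 1) {r t : B} (h : M r t = 3) : 4 * A r t * A t r = 1 := by
  have hrt : t ≠ r := by rintro rfl; simp at h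
  have h1 := simple_braid_apply cs (ρ := ρ) h (α r)
  simp only [hα _ _, map_sub, map_smul, hA] at h1
  have h2 := congrArg (fun w => α.repr w r) h1
  simp [hrt.symm] at h2
  linear_combination h2

theorem IsIR.exists_frame (h : IsIR cs ρ) :
    ∃ (α : Module.Basis B ℂ V) (A : Matrix B B ℂ), IsFrame cs ρ A α ∧ ∀ r, A r r = 1 := by
  obtain ⟨α, hα⟩ := h
  have key : ∀ r t, ∃ c : ℂ, ρ (cs.simple r) (α t) = α t - (2 * c) • α r := by
    intro r t
    obtain ⟨⟨H, hH, hfix⟩, hneg⟩ := hα r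
    have hmem : α r ∉ H := by
      intro hr
      have h1 := hfix _ hr
      rw [hneg, neg_eq_iff_add_eq_zero, ← two_smul ℂ] at h1
      exact α.ne_zero r ((smul_eq_zero_iff_right two_ne_zero).mp h1)
    obtain ⟨c, hc⟩ := (finrank_eq_one_iff_of_nonzero' (H.mkQ (α r))
      (by simpa using hmem)).mp hH (H.mkQ (α t))
    rw [← map_smul, ← sub_eq_zero, ← map_sub, Submodule.mkQ_apply,
      Submodule.Quotient.mk_eq_zero] at hc
    have h1 := hfix _ hc
    rw [map_sub, map_smul, hneg] at h1
    refine ⟨c, ?_⟩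
    linear_combination (norm := module) (-1 : ℂ) • h1
  choose A hA using key
  refine ⟨α, Matrix.of A, hA, fun r => ?_⟩
  have h1 := (hα r).2
  rw [hA r r] at h1
  have h2 := congrArg (fun w => α.repr w r) h1
  simp at h2
  simp only [Matrix.of_apply]
  linear_combination (-1 / 2 : ℂ) * h2

end Relations

namespace IRDatum

variable {B : Type*} [DecidableEq B] {M : CoxeterMatrix B} (D : IRDatum M)

theorem matrixA_self (r : B) : D.matrixA r r = 1 := by simp [matrixA]

theorem matrixA_of_eq_three {r t : B} (h : M r t = 3) :
    D.matrixA r t = -(D.a r t / D.a t r) / 2 := by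
  have hrt : r ≠ t := by rintro rfl; simp at h
  have hk : D.k r t = 1 := by
    have := D.one_le_k r t hrt
    have := D.two_mul_k_le r t hrt
    omega
  have : D.angle r t = Real.pi / 3 := by simp [angle, hk, h]
  simp only [matrixA, Matrix.of_apply, hrt, if_false, this, Real.cos_pi_div_three]
  push_cast
  ring

theorem matrixA_of_eq_two {r t : B} (h : M r t = 2) : D.matrixA r t = 0 := by
  have hrt : r ≠ t := by rintro rfl; simp at h
  have hk : D.k r t = 1 := by
    have := D.one_le_k r t hrt
    have := D.two_mul_k_le r t hrt
    omega
  have : D.angle r t = Real.pi / 2 := by simp [angle, hk, h]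
  simp [matrixA, hrt, this]

theorem defines_iff {W V : Type*} [Group W] [AddCommGroup V] [Module ℂ V]
    {cs : CoxeterSystem M W} {ρ : Representation ℂ W V} :
    D.Defines cs ρ ↔ ∃ α : Module.Basis B ℂ V, IsFrame cs ρ D.matrixA α := by
  refine exists_congr fun α => forall_congr' fun r => ⟨fun h t => ?_, fun h => ⟨?_, ?_⟩⟩
  · rcases eq_or_ne t r with rfl | htr
    · rw [h.1, matrixA_self]
      module
    · rw [h.2 t htr]
      simp only [matrixA, Matrix.of_apply, htr.symm, if_false]
      module
  · rw [h r, matrixA_self]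
    module
  · intro t htr
    rw [h t]
    simp only [matrixA, Matrix.of_apply, htr.symm, if_false]
    module

variable [Fintype B]

theorem isFrame_rep {W : Type*} [Group W] (cs : CoxeterSystem M W) :
    IsFrame cs (D.rep cs) D.matrixA (Pi.basisFun ℂ B) := by
  intro r t
  rw [rep_simple, refl_apply]
  simp

/-- The intertwining map from the representation of a datum determined by a frame. -/
def homOfFrame {W V : Type*} [Group W] [AddCommGroup V] [Module ℂ V]
    {cs : CoxeterSystem M W} {ρ : Representation ℂ W V} {e : B → V}
    (he : IsFrame cs ρ D.matrixA e) : (D.rep cs).IntertwiningMap ρ where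
  toLinearMap := Fintype.linearCombination ℂ e
  isIntertwining' g := by
    have hs : ∀ r, Fintype.linearCombination ℂ e ∘ₗ D.rep cs (cs.simple r) =
        ρ (cs.simple r) ∘ₗ Fintype.linearCombination ℂ e := fun r => by
      refine (Pi.basisFun ℂ B).ext fun t => ?_
      simp only [LinearMap.comp_apply, D.isFrame_rep cs r t, map_sub, map_smul]
      simp [he r t]
    induction g using cs.simple_induction with
    | simple r => exact hs r
    | one => simp [Module.End.one_eq_id]
    | mul g h hg hh =>
      rw [map_mul, map_mul, Module.End.mul_eq_comp, Module.End.mul_eq_comp,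
        ← LinearMap.comp_assoc, hg, LinearMap.comp_assoc, hh, LinearMap.comp_assoc]

theorem homOfFrame_apply {W V : Type*} [Group W] [AddCommGroup V] [Module ℂ V]
    {cs : CoxeterSystem M W} {ρ : Representation ℂ W V} {e : B → V}
    (he : IsFrame cs ρ D.matrixA e) (v : B → ℂ) : D.homOfFrame he v = ∑ i, v i • e i :=
  Fintype.linearCombination_apply ℂ e v

theorem homOfFrame_bijective {W V : Type*} [Group W] [AddCommGroup V] [Module ℂ V]
    {cs : CoxeterSystem M W} {ρ : Representation ℂ W V} {α : Module.Basis B ℂ V}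
    (hα : IsFrame cs ρ D.matrixA α) : Function.Bijective (D.homOfFrame hα) := by
  have : ⇑(D.homOfFrame hα) = α.equivFun.symm := by
    ext v
    rw [homOfFrame_apply, Module.Basis.equivFun_symm_apply]
  rw [this]
  exact α.equivFun.symm.bijective

end IRDatum

section AffineA

variable {n : ℕ}

theorem fin_add_one_ne (hn : 2 ≤ n) (i : Fin (n + 1)) : i + 1 ≠ i := by
  obtain ⟨m, rfl⟩ := Nat.exists_eq_add_of_le' hn
  simp

theorem fin_add_one_add_one_ne (hn : 2 ≤ n) (i : Fin (n + 1)) : i + 1 + 1 ≠ i := by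
  obtain ⟨m, rfl⟩ := Nat.exists_eq_add_of_le' hn
  intro h
  have h1 := congrArg Fin.val (add_eq_left.mp ((add_assoc i 1 1).symm.trans h))
  rw [Fin.val_add, Fin.val_one, Nat.mod_eq_of_lt (by omega)] at h1
  simp at h1

theorem affineA_add_one_left (hn : 2 ≤ n) (i : Fin (n + 1)) : affineA n (i + 1) i = 3 := by
  change (if i + 1 = i then 1 else if i = i + 1 + 1 ∨ i + 1 = i + 1 then 3 else 2) = 3
  simp [fin_add_one_ne hn]

theorem affineA_add_one_right (hn : 2 ≤ n) (i : Fin (n + 1)) : affineA n i (i + 1) = 3 := by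
  rw [(affineA n).symmetric, affineA_add_one_left hn]

theorem affineA_of_not_adj {i j : Fin (n + 1)} (h : i ≠ j) (h1 : j ≠ i + 1) (h2 : i ≠ j + 1) :
    affineA n i j = 2 := by
  change (if i = j then 1 else if j = i + 1 ∨ i = j + 1 then 3 else 2) = 2
  simp [h, h1, h2]

/-- Induction along the circuit of type `Ã_n`. -/
theorem fin_cyclic_induction {p : Fin (n + 1) → Prop} {i : Fin (n + 1)} (hi : p i)
    (h : ∀ j, p j → p (j + 1)) (k : Fin (n + 1)) : p k := by
  have h1 : ∀ m : ℕ, p (i + Fin.ofNat (n + 1) m) := by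
    intro m
    induction m with
    | zero => simpa using hi
    | succ m ih =>
      have h2 : Fin.ofNat (n + 1) (m + 1) = Fin.ofNat (n + 1) m + 1 := by
        ext
        simp [Fin.val_add]
      rw [h2, ← add_assoc]
      exact h _ ih
  simpa using h1 (k - i).val

/-- The monodromy around the circuit, read off from the matrix of a frame. -/
def circuitProd (A : Matrix (Fin (n + 1)) (Fin (n + 1)) ℂ) : ℂ := ∏ i, (-2 * A (i + 1) i)

theorem circuitProd_matrixA (hn : 2 ≤ n) (D : IRDatum (affineA n)) :
    circuitProd D.matrixA = monodromy D := by
  refine Finset.prod_congr rfl fun i _ => ?_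
  rw [D.matrixA_of_eq_three (affineA_add_one_left hn i)]
  ring

/-- The datum with a prescribed matrix. -/
theorem exists_datum_matrixA (A : Matrix (Fin (n + 1)) (Fin (n + 1)) ℂ)
    (h1 : ∀ r, A r r = 1) (h2 : ∀ r t, affineA n r t = 2 → A r t = 0)
    (h3 : ∀ r t, affineA n r t = 3 → 4 * A r t * A t r = 1) :
    ∃ D : IRDatum (affineA n), D.matrixA = A := by
  let D : IRDatum (affineA n) :=
    { k := fun _ _ => 1
      a := fun r t => if r < t ∧ A r t ≠ 0 then -2 * A r t else 1
      one_le_k := fun _ _ _ => le_rfl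
      two_mul_k_le := (geometricDatum (affineA n) (affineA_ne_zero n)).two_mul_k_le
      k_symm := fun _ _ _ => rfl
      a_ne_zero := fun r t _ => by
        split_ifs with h
        · simpa using h.2
        · exact one_ne_zero }
  refine ⟨D, Matrix.ext fun r t => ?_⟩
  rcases eq_or_ne r t with rfl | hrt
  · rw [D.matrixA_self, h1]
  have hM : affineA n r t = 2 ∨ affineA n r t = 3 := by
    change (if r = t then 1 else if t = r + 1 ∨ r = t + 1 then 3 else 2) = 2 ∨
      (if r = t then 1 else if t = r + 1 ∨ r = t + 1 then 3 else 2) = 3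
    simp only [hrt, if_false]
    split_ifs <;> simp
  rcases hM with hM | hM
  · rw [D.matrixA_of_eq_two hM, h2 r t hM]
  · have h4 := h3 r t hM
    have hr : A r t ≠ 0 := by intro h; simp [h] at h4
    have ht : A t r ≠ 0 := by intro h; simp [h] at h4
    rw [D.matrixA_of_eq_three hM]
    rcases lt_or_gt_of_ne hrt with hlt | hlt
    · simp only [D, hlt, hlt.not_gt, hr, true_and, false_and, if_true, if_false, ne_eq,
        not_false_eq_true]
      ring
    · simp only [D, hlt, hlt.not_gt, ht, true_and, false_and, if_true, if_false, ne_eq,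
        not_false_eq_true]
      field_simp
      linear_combination (-1 : ℂ) * h4

theorem datumX_matrixA_add_one_left (hn : 2 ≤ n) (x : ℂˣ) (i : Fin (n + 1)) :
    (datumX n x).matrixA (i + 1) i = -(if i = Fin.last n then (x : ℂ) else 1) / 2 := by
  rw [IRDatum.matrixA_of_eq_three _ (affineA_add_one_left hn i)]
  have h1 : i + 1 = 0 ∧ i = Fin.last n ↔ i = Fin.last n :=
    ⟨And.right, fun h => ⟨by rw [h, Fin.last_add_one], h⟩⟩
  have h2 : ¬ (i = 0 ∧ i + 1 = Fin.last n) := by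
    rintro ⟨rfl, h⟩
    apply fin_add_one_add_one_ne hn 0
    rw [h, Fin.last_add_one]
  simp only [datumX, h1, h2, if_false, div_one]

theorem datumX_matrixA_add_one_right (hn : 2 ≤ n) (x : ℂˣ) (i : Fin (n + 1)) :
    (datumX n x).matrixA i (i + 1) = -(if i = Fin.last n then (x : ℂ)⁻¹ else 1) / 2 := by
  rw [IRDatum.matrixA_of_eq_three _ (affineA_add_one_right hn i)]
  have h1 : i + 1 = 0 ∧ i = Fin.last n ↔ i = Fin.last n :=
    ⟨And.right, fun h => ⟨by rw [h, Fin.last_add_one], h⟩⟩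
  have h2 : ¬ (i = 0 ∧ i + 1 = Fin.last n) := by
    rintro ⟨rfl, h⟩
    apply fin_add_one_add_one_ne hn 0
    rw [h, Fin.last_add_one]
  simp only [datumX, h1, h2, if_false]
  split_ifs <;> simp

theorem monodromy_datumX (hn : 2 ≤ n) (x : ℂˣ) : monodromy (datumX n x) = x := by
  rw [← circuitProd_matrixA hn, circuitProd, Finset.prod_eq_single (Fin.last n)]
  · rw [datumX_matrixA_add_one_left hn, if_pos rfl]
    ring
  · intro i _ hi
    rw [datumX_matrixA_add_one_left hn, if_neg hi]
    ring
  · simp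

theorem monodromy_ne_zero (hn : 2 ≤ n) (D : IRDatum (affineA n)) : monodromy D ≠ 0 :=
  Finset.prod_ne_zero_iff.mpr fun i _ => div_ne_zero
    (D.a_ne_zero _ _ (fin_add_one_ne hn i)) (D.a_ne_zero _ _ (fin_add_one_ne hn i).symm)

variable {W : Type*} [Group W] {cs : CoxeterSystem (affineA n) W}
  {V : Type*} [AddCommGroup V] [Module ℂ V] {ρ : Representation ℂ W V}

/-- A family satisfying the relations of `V_x` for consecutive simple reflections, and commuting
otherwise, is a frame for the matrix of `V_x`. -/
theorem isFrame_datumX (hn : 2 ≤ n) (x : ℂˣ) {e : Fin (n + 1) → V}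
    (h1 : ∀ i, ρ (cs.simple i) (e i) = -e i)
    (h2 : ∀ i, ρ (cs.simple (i + 1)) (e i) =
      e i + (if i = Fin.last n then (x : ℂ) else 1) • e (i + 1))
    (h3 : ∀ i, ρ (cs.simple i) (e (i + 1)) =
      e (i + 1) + (if i = Fin.last n then (x : ℂ)⁻¹ else 1) • e i)
    (h4 : ∀ r t, affineA n r t = 2 → ρ (cs.simple r) (e t) = e t) :
    IsFrame cs ρ (datumX n x).matrixA e := by
  intro r t
  by_cases hrt : r = t
  · subst hrt
    rw [IRDatum.matrixA_self, h1]
    module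
  by_cases h5 : r = t + 1
  · subst h5
    rw [h2, datumX_matrixA_add_one_left hn]
    module
  by_cases h6 : t = r + 1
  · subst h6
    rw [h3, datumX_matrixA_add_one_right hn]
    module
  have hM := affineA_of_not_adj hrt h6 h5
  rw [h4 r t hM, IRDatum.matrixA_of_eq_two _ hM]
  simp

theorem matrix_ext_affineA {A A' : Matrix (Fin (n + 1)) (Fin (n + 1)) ℂ}
    (h1 : ∀ i, A i i = A' i i) (h2 : ∀ i, A (i + 1) i = A' (i + 1) i)
    (h3 : ∀ i, A i (i + 1) = A' i (i + 1)) (h4 : ∀ r t, affineA n r t = 2 → A r t = A' r t) :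
    A = A' := by
  ext r t
  by_cases hrt : r = t
  · subst hrt; exact h1 r
  by_cases h5 : r = t + 1
  · subst h5; exact h2 t
  by_cases h6 : t = r + 1
  · subst h6; exact h3 r
  exact h4 r t (affineA_of_not_adj hrt h6 h5)

theorem isFrame_rescale {A A' : Matrix (Fin (n + 1)) (Fin (n + 1)) ℂ} {e : Fin (n + 1) → V}
    (he : IsFrame cs ρ A e) (l : Fin (n + 1) → ℂ) (h : ∀ r t, A r t * l t = A' r t * l r) :
    IsFrame cs ρ A' (fun i => l i • e i) := by
  intro r t
  rw [map_smul, he r t]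
  linear_combination (norm := module) (-2 : ℂ) • congrArg (· • e r) (h r t)

/-- Proportional bases give frames with the same product around the circuit. -/
theorem circuitProd_eq {A A' : Matrix (Fin (n + 1)) (Fin (n + 1)) ℂ}
    {α α' : Module.Basis (Fin (n + 1)) ℂ V} (hα : IsFrame cs ρ A α) (hα' : IsFrame cs ρ A' α')
    (hA' : ∀ r, A' r r = 1) : circuitProd A = circuitProd A' := by
  have hspan : ∀ r v, ∃ c : ℂ, v - ρ (cs.simple r) v = c • α r := by
    intro r v
    have hv : v ∈ Submodule.span ℂ (Set.range α) := by simp [α.span_eq]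
    induction hv using Submodule.span_induction with
    | zero => exact ⟨0, by simp⟩
    | mem w hw =>
      obtain ⟨t, rfl⟩ := hw
      exact ⟨2 * A r t, by rw [hα r t]; module⟩
    | add v w _ _ hv hw =>
      obtain ⟨c, hc⟩ := hv
      obtain ⟨d, hd⟩ := hw
      exact ⟨c + d, by rw [add_smul, ← hc, ← hd, map_add]; abel⟩
    | smul a v _ hv =>
      obtain ⟨c, hc⟩ := hv
      exact ⟨a * c, by rw [mul_smul, ← hc, map_smul, smul_sub]⟩
  have hl : ∀ r, ∃ l : ℂ, α' r = l • α r := by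
    intro r
    obtain ⟨c, hc⟩ := hspan r (α' r)
    rw [hα' r r, hA'] at hc
    refine ⟨c / 2, ?_⟩
    rw [div_eq_inv_mul, mul_smul, ← hc]
    module
  choose l hl using hl
  have hl0 : ∀ r, l r ≠ 0 := fun r h => α'.ne_zero r (by rw [hl, h, zero_smul])
  have key : ∀ r t, A r t * l t = A' r t * l r := by
    intro r t
    have h1 := hα' r t
    rw [hl r, hl t, map_smul, hα r t] at h1
    have h2 : ((2 * A r t) * l t - (2 * A' r t) * l r) • α r = 0 := by
      linear_combination (norm := module) (-1 : ℂ) • h1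
    have h3 := (smul_eq_zero_iff_left (α.ne_zero r)).mp h2
    linear_combination (1 / 2 : ℂ) * h3
  have hprod : ∏ i, l (i + 1) = ∏ i, l i := Equiv.prod_comp (Equiv.addRight (1 : Fin (n + 1))) l
  have h1 : circuitProd A * ∏ i, l i = circuitProd A' * ∏ i, l i := by
    conv_rhs => rw [← hprod]
    rw [circuitProd, circuitProd, ← Finset.prod_mul_distrib, ← Finset.prod_mul_distrib]
    refine Finset.prod_congr rfl fun i _ => ?_
    linear_combination (-2 : ℂ) * key (i + 1) i
  exact mul_right_cancel₀ (Finset.prod_ne_zero_iff.mpr fun i _ => hl0 i) h1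

/-- A datum of monodromy `x` defines a representation isomorphic to `V_x`. -/
theorem nonempty_equiv_repX (hn : 2 ≤ n) {D : IRDatum (affineA n)} (hD : D.Defines cs ρ)
    {x : ℂˣ} (hx : monodromy D = x) : Nonempty (ρ.Equiv (repX cs x)) := by
  obtain ⟨α, hα⟩ := D.defines_iff.mp hD
  let c : ℕ → ℂ := fun k => -2 * D.matrixA (Fin.ofNat (n + 1) k + 1) (Fin.ofNat (n + 1) k)
  have hadj : ∀ i, 4 * D.matrixA (i + 1) i * D.matrixA i (i + 1) = 1 := fun i =>
    hα.mul_eq D.matrixA_self (affineA_add_one_left hn i)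
  have hc : ∀ k, c k ≠ 0 := fun k h => by
    have h1 := hadj (Fin.ofNat (n + 1) k)
    simp only [c, mul_eq_zero] at h
    rcases h with h | h
    · norm_num at h
    · rw [h] at h1
      simp at h1
  let l : Fin (n + 1) → ℂ := fun i => ∏ k ∈ Finset.range i, c k
  have hl0 : ∀ i, l i ≠ 0 := fun i => Finset.prod_ne_zero_iff.mpr fun k _ => hc k
  have hci : ∀ i : Fin (n + 1), c i = -2 * D.matrixA (i + 1) i := fun i => by simp [c]
  have hl : ∀ i, l i * c i = (if i = Fin.last n then (x : ℂ) else 1) * l (i + 1) := by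
    intro i
    rw [show l i * c i = ∏ k ∈ Finset.range (i + 1), c k from (Finset.prod_range_succ _ _).symm]
    split_ifs with h
    · subst h
      rw [Fin.last_add_one, ← hx, ← circuitProd_matrixA hn]
      simp only [l, Fin.val_zero, Finset.range_zero, Finset.prod_empty, mul_one, Fin.val_last]
      rw [Finset.prod_range]
      exact Finset.prod_congr rfl fun i _ => hci i
    · rw [one_mul]
      simp only [l, Fin.val_add_one, h, if_false]
  have hframe : IsFrame cs ρ (datumX n x).matrixA
      (α.isUnitSMul fun i => (isUnit_iff_ne_zero.mpr (hl0 i))) := by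
    have : ⇑(α.isUnitSMul fun i => (isUnit_iff_ne_zero.mpr (hl0 i))) = fun i => l i • α i :=
      funext fun i => Module.Basis.isUnitSMul_apply _ i
    rw [this]
    refine isFrame_rescale hα l fun r t => ?_
    have key : (Matrix.of fun r t => D.matrixA r t * l t / l r) = (datumX n x).matrixA := by
      refine matrix_ext_affineA (fun i => ?_) (fun i => ?_) (fun i => ?_) (fun r t h => ?_)
      · simp [IRDatum.matrixA_self, hl0]
      · rw [datumX_matrixA_add_one_left hn, Matrix.of_apply, div_eq_iff (hl0 _)]
        linear_combination (-1 / 2 : ℂ) * hl i + (1 / 2 * l i) * hci i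
      · rw [datumX_matrixA_add_one_right hn, Matrix.of_apply, div_eq_iff (hl0 _)]
        have h1 := hl i
        have h2 := hadj i
        rw [hci] at h1
        have h3 : (if i = Fin.last n then (x : ℂ)⁻¹ else 1) =
            (if i = Fin.last n then (x : ℂ) else 1)⁻¹ := by split_ifs <;> simp
        have h4 : (if i = Fin.last n then (x : ℂ) else 1) ≠ 0 := by split_ifs <;> simp
        rw [h3]
        field_simp
        linear_combination (-2 * D.matrixA i (i + 1)) * h1 - l i * h2
      · simp [IRDatum.matrixA_of_eq_two _ h]
    rw [← key, Matrix.of_apply, div_mul_cancel₀ _ (hl0 r)]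
  exact ⟨(((datumX n x).homOfFrame hframe).ofBijective
    ((datumX n x).homOfFrame_bijective hframe)).symm⟩

theorem IsIR.existsUnique_monodromy (hn : 2 ≤ n) (h : IsIR cs ρ) :
    ∃! x : ℂ, x ≠ 0 ∧ HasMonodromy cs ρ x := by
  obtain ⟨α, A, hα, hA⟩ := h.exists_frame
  obtain ⟨D, rfl⟩ := exists_datum_matrixA A hA (fun r t => hα.eq_zero hA)
    (fun r t => hα.mul_eq hA)
  refine ⟨monodromy D, ⟨monodromy_ne_zero hn D, D, D.defines_iff.mpr ⟨α, hα⟩, rfl⟩, ?_⟩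
  rintro _ ⟨-, D', hD', rfl⟩
  obtain ⟨α', hα'⟩ := D'.defines_iff.mp hD'
  rw [← circuitProd_matrixA hn, ← circuitProd_matrixA hn]
  exact circuitProd_eq hα' hα hA

theorem hasMonodromy_repX (hn : 2 ≤ n) (x : ℂˣ) : HasMonodromy cs (repX cs x) x :=
  ⟨datumX n x, (datumX n x).defines_rep cs, monodromy_datumX hn x⟩

theorem hasMonodromy_iff (hn : 2 ≤ n) (x : ℂˣ) :
    HasMonodromy cs ρ x ↔ Nonempty (ρ.Equiv (repX cs x)) := by
  constructor
  · rintro ⟨D, hD, hx⟩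
    exact nonempty_equiv_repX hn hD hx
  · rintro ⟨f⟩
    refine ⟨datumX n x, (datumX n x).defines_iff.mpr
      ⟨(Pi.basisFun ℂ (Fin (n + 1))).map f.toLinearEquiv.symm, ?_⟩, monodromy_datumX hn x⟩
    exact ((datumX n x).isFrame_rep cs).map f.symm.toIntertwiningMap

end AffineA

theorem isIR_rep {B W : Type*} [DecidableEq B] [Fintype B] [Group W] {M : CoxeterMatrix B}
    (D : IRDatum M) (cs : CoxeterSystem M W) : IsIR cs (D.rep cs) := by
  refine ⟨Pi.basisFun ℂ B, fun r =>
    ⟨⟨LinearMap.ker (LinearMap.proj r ∘ₗ D.matrixA.mulVecLin), ?_, fun v hv => ?_⟩, ?_⟩⟩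
  · have hsurj : Function.Surjective
        (LinearMap.proj r ∘ₗ D.matrixA.mulVecLin : (B → ℂ) →ₗ[ℂ] ℂ) := fun c =>
      ⟨c • Pi.single r 1, by simp [D.matrixA_self]⟩
    rw [(LinearMap.quotKerEquivOfSurjective _ hsurj).finrank_eq, Module.finrank_self]
  · rw [D.rep_simple, D.refl_apply]
    have : (D.matrixA *ᵥ v) r = 0 := hv
    simp [this]
  · rw [D.rep_simple]
    simpa using D.refl_single_self r

section Determinant

variable {n : ℕ}

/-- The weighted cyclic shift `e_j ↦ e_{j+1}`, of weight `y` on the last basis vector and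
weight one on the others. -/
def cyclicShift (n : ℕ) (y : ℂ) : Matrix (Fin (n + 1)) (Fin (n + 1)) ℂ :=
  Matrix.of fun i j => if i = j + 1 then (if j = Fin.last n then y else 1) else 0

theorem cyclicShift_mul_transpose (x : ℂˣ) :
    cyclicShift n x * (cyclicShift n (x : ℂ)⁻¹)ᵀ = 1 := by
  ext i j
  rw [Matrix.mul_apply, Finset.sum_eq_single (i - 1)]
  · rcases eq_or_ne i j with rfl | h
    · simp only [cyclicShift, Matrix.of_apply, Matrix.transpose_apply, sub_add_cancel, if_true,
        Matrix.one_apply_eq]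
      split_ifs <;> simp
    · simp [cyclicShift, h, h.symm]
  · intro k _ hk
    have : i ≠ k + 1 := fun h => hk (by simp [h])
    simp [cyclicShift, this]
  · simp

theorem det_one_sub_cyclicShift (hn : 2 ≤ n) (y : ℂ) : (1 - cyclicShift n y).det = 1 - y := by
  obtain ⟨m, rfl⟩ := Nat.exists_eq_add_of_le' hn
  rw [Matrix.det_succ_row_zero, Finset.sum_eq_add (0 : Fin (m + 2 + 1)) (Fin.last (m + 2))
    (by simp [Fin.ext_iff])]
  · have h1 : ((1 - cyclicShift (m + 2) y).submatrix Fin.succ (Fin.succAbove 0)).det = 1 := by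
      rw [Matrix.det_of_isLowerTriangular]
      · refine Finset.prod_eq_one fun i _ => ?_
        have : i.succ ≠ i.succ + 1 := (fin_add_one_ne hn _).symm
        simp [cyclicShift, this]
      · intro i j hij
        replace hij : i < j := hij
        have h2 : i.succ ≠ j.succ + 1 := by
          intro h
          have h3 := congrArg Fin.val h
          rw [Fin.val_add_one] at h3
          split_ifs at h3
          · simp at h3
          · simp only [Fin.val_succ] at h3
            omega
        simp [cyclicShift, h2, hij.ne]
    have h2 : ((1 - cyclicShift (m + 2) y).submatrix Fin.succ
        (Fin.succAbove (Fin.last (m + 2)))).det = (-1) ^ (m + 2) := by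
      rw [Matrix.det_of_isUpperTriangular]
      · rw [Finset.prod_eq_pow_card (b := -1)]
        · simp
        · intro i _
          have : i.succ ≠ i.castSucc := by simp [Fin.ext_iff]
          simp [cyclicShift, this, Fin.castSucc_ne_last]
      · intro i j hij
        replace hij : j < i := hij
        have h3 : i.succ ≠ j.castSucc := by
          intro h
          have h3 := congrArg Fin.val h
          simp only [Fin.val_succ, Fin.val_castSucc] at h3
          omega
        simp [cyclicShift, h3, hij.ne']
    have h3 : Fin.last (m + 2) ≠ 0 := by simp [Fin.ext_iff]
    rw [h1, h2]
    have h4 : ((-1 : ℂ) ^ (m + 2)) * (-1) ^ (m + 2) = 1 := by rw [← mul_pow]; simp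
    simp [cyclicShift, h3.symm]
    linear_combination (-y) * h4
  · intro j _ hj
    have h1 : (0 : Fin (m + 2 + 1)) ≠ j + 1 := by
      intro h
      exact hj.2 (add_right_cancel (h.symm.trans (Fin.last_add_one _).symm))
    simp [cyclicShift, h1, hj.1.symm]
  · simp
  · simp

theorem two_smul_matrixA_datumX (hn : 2 ≤ n) (x : ℂˣ) :
    (2 : ℂ) • (datumX n x).matrixA =
      (1 - cyclicShift n x) * (1 - (cyclicShift n (x : ℂ)⁻¹)ᵀ) := by
  have h : (1 - cyclicShift n x) * (1 - (cyclicShift n (x : ℂ)⁻¹)ᵀ) =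
      (2 : ℂ) • 1 - cyclicShift n x - (cyclicShift n (x : ℂ)⁻¹)ᵀ := by
    rw [sub_mul, mul_sub, mul_sub, cyclicShift_mul_transpose]
    simp only [mul_one, one_mul]
    module
  rw [h]
  have hne := fin_add_one_ne hn
  have hne' := fin_add_one_add_one_ne hn
  refine matrix_ext_affineA (fun i => ?_) (fun i => ?_) (fun i => ?_) (fun r t hrt => ?_)
  · simp [IRDatum.matrixA_self, cyclicShift, (hne i).symm]
  · simp [datumX_matrixA_add_one_left hn, cyclicShift, hne i, (hne' i).symm]
    ring
  · simp [datumX_matrixA_add_one_right hn, cyclicShift, (hne i).symm, (hne' i).symm]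
    ring
  · have h1 : r ≠ t := by rintro rfl; simp at hrt
    have h2 : r ≠ t + 1 := by rintro rfl; simp [affineA_add_one_left hn] at hrt
    have h3 : t ≠ r + 1 := by rintro rfl; simp [affineA_add_one_right hn] at hrt
    simp [IRDatum.matrixA_of_eq_two _ hrt, cyclicShift, h1, h2, h3]

theorem det_matrixA_datumX (hn : 2 ≤ n) (x : ℂˣ) :
    (datumX n x).matrixA.det = (2 - (x : ℂ) - (x : ℂ)⁻¹) / 2 ^ (n + 1) := by
  have h := congrArg Matrix.det (two_smul_matrixA_datumX hn x)
  have h1 : (1 - (cyclicShift n (x : ℂ)⁻¹)ᵀ).det = 1 - (x : ℂ)⁻¹ := by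
    rw [← det_one_sub_cyclicShift hn, ← Matrix.det_transpose]
    simp
  rw [Matrix.det_smul, Matrix.det_mul, det_one_sub_cyclicShift hn, h1, Fintype.card_fin] at h
  have hx : (x : ℂ) ≠ 0 := x.ne_zero
  rw [eq_div_iff (pow_ne_zero _ two_ne_zero), mul_comm, h]
  field_simp
  ring

end Determinant

section Subrepresentations

variable {n : ℕ} {W : Type*} [Group W] {cs : CoxeterSystem (affineA n) W}

theorem repX_simple (x : ℂˣ) (r : Fin (n + 1)) (v : Fin (n + 1) → ℂ) :
    repX cs x (cs.simple r) v = v - (2 * ((datumX n x).matrixA *ᵥ v) r) • Pi.single r 1 := by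
  rw [repX, IRDatum.rep_simple, IRDatum.refl_apply]

/-- A subrepresentation of `V_x` not contained in the kernel of `A` is everything. -/
theorem subrep_repX_eq_top (hn : 2 ≤ n) (x : ℂˣ) (U : Subrepresentation (repX cs x))
    {v : Fin (n + 1) → ℂ} (hv : v ∈ U.toSubmodule) (hA : (datumX n x).matrixA *ᵥ v ≠ 0) :
    U = ⊤ := by
  set D := datumX n x with hD
  have step : ∀ w ∈ U.toSubmodule, ∀ r, (D.matrixA *ᵥ w) r ≠ 0 →
      (Pi.single r 1 : Fin (n + 1) → ℂ) ∈ U.toSubmodule := by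
    intro w hw r hr
    have h1 := U.apply_mem_toSubmodule (cs.simple r) hw
    rw [repX_simple, Submodule.sub_mem_iff_right _ hw,
      Submodule.smul_mem_iff _ (mul_ne_zero two_ne_zero hr)] at h1
    exact h1
  obtain ⟨r, hr⟩ := Function.ne_iff.mp hA
  have hall : ∀ k, (Pi.single k 1 : Fin (n + 1) → ℂ) ∈ U.toSubmodule :=
    fin_cyclic_induction (step v hv r hr) fun j hj => step _ hj _ (by
      rw [Matrix.mulVec_single_one, Matrix.col_apply, hD, datumX_matrixA_add_one_left hn]
      split_ifs <;> simp)
  apply Subrepresentation.toSubmodule_injective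
  refine (Submodule.eq_top_iff'.mpr fun w => ?_ : U.toSubmodule = ⊤)
  rw [pi_eq_sum_univ' w]
  exact Submodule.sum_mem _ fun k _ => Submodule.smul_mem _ _ (by
    simpa [Pi.single_apply, funext_iff] using! hall k)

/-- The kernel of the matrix of a datum is a subrepresentation. -/
def radical (x : ℂˣ) (cs : CoxeterSystem (affineA n) W) : Subrepresentation (repX cs x) where
  toSubmodule := LinearMap.ker (datumX n x).matrixA.mulVecLin
  apply_mem_toSubmodule g v hv := by
    have : ∀ v ∈ LinearMap.ker (datumX n x).matrixA.mulVecLin, repX cs x g v = v := by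
      induction g using cs.simple_induction with
      | simple r =>
        intro v hv
        have h : (datumX n x).matrixA *ᵥ v = 0 := hv
        rw [repX_simple, h]
        simp
      | one => simp
      | mul g h hg hh =>
        intro v hv
        rw [map_mul, Module.End.mul_apply, hh v hv, hg v hv]
    rwa [this v hv]

theorem matrixA_datumX_mulVec_single_ne_zero (x : ℂˣ) (r : Fin (n + 1)) :
    (datumX n x).matrixA *ᵥ Pi.single r 1 ≠ 0 := fun h => by
  simpa [IRDatum.matrixA_self] using congrFun h r

theorem radical_ne_top (x : ℂˣ) : radical x cs ≠ ⊤ := fun h =>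
  matrixA_datumX_mulVec_single_ne_zero x 0 (by
    have : (Pi.single 0 1 : Fin (n + 1) → ℂ) ∈ (radical x cs).toSubmodule := by
      rw [h]
      exact Submodule.mem_top
    exact this)

theorem le_radical (hn : 2 ≤ n) {x : ℂˣ} {U : Subrepresentation (repX cs x)} (hU : U ≠ ⊤) :
    U ≤ radical x cs := fun v hv => by
  by_contra h
  exact hU (subrep_repX_eq_top hn x U hv h)

instance nontrivial_subrep_repX (x : ℂˣ) : Nontrivial (Subrepresentation (repX cs x)) :=
  ⟨_, _, radical_ne_top x⟩

theorem isIrreducible_repX_iff (hn : 2 ≤ n) (x : ℂˣ) :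
    (repX cs x).IsIrreducible ↔ x ≠ 1 := by
  have hdet := det_matrixA_datumX hn x
  have hx : (x : ℂ) ≠ 0 := x.ne_zero
  have hrad : radical x cs = ⊥ ↔ (datumX n x).matrixA.det ≠ 0 := by
    rw [← not_iff_not, not_not, ← Matrix.exists_mulVec_eq_zero_iff]
    rw [← ne_eq, ← Subrepresentation.toSubmodule_injective.ne_iff]
    constructor
    · intro h
      obtain ⟨v, hv, hv0⟩ := Submodule.exists_mem_ne_zero_of_ne_bot h
      exact ⟨v, hv0, hv⟩
    · rintro ⟨v, hv0, hv⟩ h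
      have h1 : v ∈ (radical x cs).toSubmodule := hv
      rw [h] at h1
      exact hv0 h1
  have hdet' : (datumX n x).matrixA.det ≠ 0 ↔ x ≠ 1 := by
    rw [hdet, not_iff_not, div_eq_zero_iff, or_iff_left (pow_ne_zero _ two_ne_zero), Units.ext_iff,
      Units.val_one]
    constructor
    · intro h
      field_simp at h
      have : ((x : ℂ) - 1) ^ 2 = 0 := by linear_combination -h
      exact sub_eq_zero.mp (pow_eq_zero_iff two_ne_zero |>.mp this)
    · intro h
      rw [h]
      norm_num
  rw [← hdet', ← hrad]
  constructor
  · intro h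
    exact (eq_bot_or_eq_top (radical x cs)).resolve_right (radical_ne_top x)
  · intro h
    exact { eq_bot_or_eq_top := fun U => or_iff_not_imp_right.mpr fun hU =>
      le_bot_iff.mp (h ▸ le_radical hn hU) }

/-- The image of a representation is irreducible if and only if the kernel is a maximal proper
subrepresentation. -/
theorem isIrreducible_iff_isCoatom_ker {V V' : Type*} [AddCommGroup V] [Module ℂ V]
    [AddCommGroup V'] [Module ℂ V'] {G : Type*} [Group G] {ρ : Representation ℂ G V}
    {ρ' : Representation ℂ G V'} (f : ρ.IntertwiningMap ρ') (hf : Function.Surjective f) :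
    ρ'.IsIrreducible ↔ IsCoatom f.ker := by
  have hinj := Submodule.comap_injective_of_surjective (f := f.toLinearMap) hf
  constructor
  · intro h
    refine ⟨fun htop => ?_, fun U' hU' => ?_⟩
    · apply bot_ne_top (α := Subrepresentation ρ')
      apply Subrepresentation.toSubmodule_injective
      apply hinj
      exact congrArg Subrepresentation.toSubmodule htop
    · let Q : Subrepresentation ρ' :=
        { toSubmodule := U'.toSubmodule.map f.toLinearMap
          apply_mem_toSubmodule := by
            rintro g _ ⟨v, hv, rfl⟩
            exact ⟨ρ g v, U'.apply_mem_toSubmodule g hv, f.isIntertwining _ _ g v⟩ }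
      have hcomap : U'.toSubmodule = Q.toSubmodule.comap f.toLinearMap := by
        have hle : LinearMap.ker f.toLinearMap ≤ U'.toSubmodule := hU'.le
        exact (Submodule.comap_map_eq_self hle).symm
      apply Subrepresentation.toSubmodule_injective
      rcases eq_bot_or_eq_top Q with hQ | hQ
      · refine absurd ?_ hU'.ne'
        apply Subrepresentation.toSubmodule_injective
        rw [hcomap, hQ]
        rfl
      · rw [hcomap, hQ]
        rfl
  · rintro ⟨hne, hmax⟩
    have h1 : (⊥ : Subrepresentation ρ') ≠ ⊤ := fun h => hne
      (Subrepresentation.toSubmodule_injective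
        (congrArg (fun Q : Subrepresentation ρ' => Submodule.comap f.toLinearMap Q.toSubmodule) h))
    have : Nontrivial (Subrepresentation ρ') := ⟨_, _, h1⟩
    refine { eq_bot_or_eq_top := fun Q => ?_ }
    let U' : Subrepresentation ρ :=
      { toSubmodule := Q.toSubmodule.comap f.toLinearMap
        apply_mem_toSubmodule := fun g v hv => by
          rw [Submodule.mem_comap, f.toLinearMap_apply, f.isIntertwining]
          exact Q.apply_mem_toSubmodule g hv }
    have hle : f.ker ≤ U' := fun v hv => by
      have h2 : f.toLinearMap v = 0 := hv
      change f.toLinearMap v ∈ Q.toSubmodule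
      rw [h2]
      exact Q.toSubmodule.zero_mem
    rcases hle.eq_or_lt with h | h
    · left
      apply Subrepresentation.toSubmodule_injective
      apply hinj
      exact (congrArg Subrepresentation.toSubmodule h).symm
    · right
      apply Subrepresentation.toSubmodule_injective
      apply hinj
      exact congrArg Subrepresentation.toSubmodule (hmax _ h)

/-- The projection onto the quotient by a subrepresentation. -/
def quotientMap {V : Type*} [AddCommGroup V] [Module ℂ V] {G : Type*} [Group G]
    (ρ : Representation ℂ G V) (U : Subrepresentation ρ) :
    ρ.IntertwiningMap (quotientRep ρ U) where
  toLinearMap := U.toSubmodule.mkQ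
  isIntertwining' _ := rfl

theorem isIrreducible_quotientRep_iff {V : Type*} [AddCommGroup V] [Module ℂ V]
    {G : Type*} [Group G] (ρ : Representation ℂ G V) (U : Subrepresentation ρ) :
    (quotientRep ρ U).IsIrreducible ↔ IsCoatom U := by
  have hker : (quotientMap ρ U).ker = U :=
    Subrepresentation.toSubmodule_injective (Submodule.ker_mkQ _)
  rw [isIrreducible_iff_isCoatom_ker (quotientMap ρ U) U.toSubmodule.mkQ_surjective, hker]

theorem isCoatom_subrep_repX_iff (hn : 2 ≤ n) {x : ℂˣ} (U : Subrepresentation (repX cs x)) :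
    IsCoatom U ↔ U = radical x cs := by
  constructor
  · intro h
    by_contra hne
    exact radical_ne_top x (h.2 _ ((le_radical hn h.1).lt_of_ne hne))
  · rintro rfl
    exact ⟨radical_ne_top x, fun U hU => by
      by_contra h
      exact hU.not_ge (le_radical hn h)⟩

theorem geometricRep_eq : geometricRep cs = repX cs 1 := by
  have : geometricDatum (affineA n) (affineA_ne_zero n) = datumX n 1 := by
    simp [geometricDatum, datumX]
  rw [geometricRep, this, repX]

/-- The first isomorphism theorem for representations. -/
theorem nonempty_equiv_quotientRep {V V' : Type*} [AddCommGroup V] [Module ℂ V]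
    [AddCommGroup V'] [Module ℂ V'] {G : Type*} [Group G] {ρ : Representation ℂ G V}
    {ρ' : Representation ℂ G V'} (f : ρ.IntertwiningMap ρ') (hf : Function.Surjective f) :
    Nonempty (ρ'.Equiv (quotientRep ρ f.ker)) := by
  let g : (quotientRep ρ f.ker).IntertwiningMap ρ' :=
    { toLinearMap := f.ker.toSubmodule.liftQ f.toLinearMap le_rfl
      isIntertwining' := fun w => by
        refine Submodule.linearMap_qext _ (LinearMap.ext fun v => ?_)
        exact f.isIntertwining _ _ w v }
  refine ⟨(g.ofBijective ⟨?_, fun v => ?_⟩).symm⟩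
  · exact LinearMap.ker_eq_bot.mp (Submodule.ker_liftQ_eq_bot _ _ _ le_rfl)
  · obtain ⟨w, rfl⟩ := hf v
    exact ⟨Submodule.Quotient.mk w, rfl⟩

end Subrepresentations

section Schur

open Polynomial

/-- If an automorphism `T` of a complex vector space of arbitrary dimension admits no proper
nonzero subspace invariant under `T` and `T⁻¹`, then `T` is a scalar. -/
theorem exists_eq_smul_of_invariant {E : Type*} [AddCommGroup E] [Module ℂ E] [Nontrivial E]
    (T : E ≃ₗ[ℂ] E)
    (h : ∀ N : Submodule ℂ E, (∀ w ∈ N, T w ∈ N) → (∀ w ∈ N, T.symm w ∈ N) → N = ⊥ ∨ N = ⊤) :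
    ∃ x : ℂ, ∀ w, T w = x • w := by
  let f : Module.End ℂ E := T
  have hf : ∀ w, f w = T w := fun _ => rfl
  by_cases hspec : ∃ x, x ∈ spectrum ℂ f
  · obtain ⟨x, hx⟩ := hspec
    refine ⟨x, ?_⟩
    set g : Module.End ℂ E := algebraMap ℂ _ x - f with hg
    have hgw : ∀ w, g w = x • w - T w := fun w => by simp [hg, hf]
    have hzero : g = 0 := by
      have hker := h (LinearMap.ker g)
        (fun w hw => by
          rw [LinearMap.mem_ker, hgw] at hw ⊢
          rw [← map_smul, ← map_sub, hw, map_zero])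
        (fun w hw => by
          rw [LinearMap.mem_ker, hgw] at hw ⊢
          rw [← map_smul, sub_eq_zero.mp hw, T.symm_apply_apply, T.apply_symm_apply, sub_self])
      have hrange := h (LinearMap.range g)
        (by
          rintro _ ⟨w, rfl⟩
          exact ⟨T w, by simp only [hgw, map_sub, map_smul]⟩)
        (by
          rintro _ ⟨w, rfl⟩
          exact ⟨T.symm w, by
            simp only [hgw, map_sub, map_smul, T.apply_symm_apply, T.symm_apply_apply]⟩)
      rcases hker with hker | hker
      · rcases hrange with hrange | hrange
        · exact LinearMap.range_eq_bot.mp hrange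
        · exact absurd ((Module.End.isUnit_iff _).mpr
            ⟨LinearMap.ker_eq_bot.mp hker, LinearMap.range_eq_top.mp hrange⟩)
            (spectrum.mem_iff.mp hx)
      · exact LinearMap.ker_eq_top.mp hker
    intro w
    have h1 := hgw w
    rw [hzero, LinearMap.zero_apply] at h1
    exact (sub_eq_zero.mp h1.symm).symm
  · exfalso
    push Not at hspec
    obtain ⟨v, hv⟩ := exists_ne (0 : E)
    let N : Submodule ℂ E :=
      { carrier := {w | ∃ (m : ℕ) (q : ℂ[X]), (f ^ m) w = aeval f q v}
        zero_mem' := ⟨0, 0, by simp⟩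
        add_mem' := by
          rintro a b ⟨m, q, ha⟩ ⟨m', q', hb⟩
          refine ⟨m + m', X ^ m' * q + X ^ m * q', ?_⟩
          simp only [map_add, map_mul, map_pow, aeval_X, LinearMap.add_apply,
            Module.End.mul_apply, ← ha, ← hb]
          simp only [← Module.End.mul_apply, ← pow_add, add_comm m' m]
        smul_mem' := by
          rintro c a ⟨m, q, ha⟩
          exact ⟨m, c • q, by rw [map_smul, ha, map_smul, LinearMap.smul_apply]⟩ }
    have hN : N = ⊤ := by
      refine (h N ?_ ?_).resolve_left fun hbot => ?_
      · rintro w ⟨m, q, hw⟩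
        refine ⟨m, X * q, ?_⟩
        rw [map_mul, aeval_X, Module.End.mul_apply, ← hw, ← hf, ← Module.End.mul_apply,
          ← Module.End.mul_apply, ← pow_succ, ← pow_succ']
      · rintro w ⟨m, q, hw⟩
        refine ⟨m + 1, q, ?_⟩
        rw [pow_succ, Module.End.mul_apply, hf, T.apply_symm_apply, hw]
      · have hvN : v ∈ N := ⟨0, 1, by simp⟩
        rw [hbot] at hvN
        exact hv hvN
    have h1 : IsUnit (algebraMap ℂ (Module.End ℂ E) 1 - f) := by
      simpa [spectrum.mem_iff] using hspec 1
    obtain ⟨w, hw⟩ := ((Module.End.isUnit_iff _).mp h1).2 v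
    obtain ⟨m, q, hq⟩ : w ∈ N := by rw [hN]; exact Submodule.mem_top
    have hP : aeval f (X ^ m - (C 1 - X) * q) v = 0 := by
      rw [map_sub, map_mul, map_pow, map_sub, aeval_X, aeval_C, LinearMap.sub_apply,
        Module.End.mul_apply, ← hq, ← hw, ← Module.End.mul_apply, ← Module.End.mul_apply,
        ((Algebra.commute_algebraMap_left 1 (f ^ m)).sub_left (Commute.self_pow f m)).eq,
        sub_self]
    set P : ℂ[X] := X ^ m - (C 1 - X) * q with hPdef
    have hP1 : P.eval 1 = 1 := by simp [hPdef]
    have hdeg : 0 < P.degree := by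
      by_contra hdeg
      rw [eq_C_of_degree_le_zero (not_lt.mp hdeg)] at hP hP1
      rw [eval_C] at hP1
      rw [hP1] at hP
      simp [hv] at hP
    have hmem : (0 : ℂ) ∈ spectrum ℂ (aeval f P) := by
      rw [spectrum.zero_mem_iff, Module.End.isUnit_iff]
      exact fun hb => hv (hb.1 (hP.trans (map_zero _).symm))
    rw [spectrum.map_polynomial_aeval_of_degree_pos f P hdeg] at hmem
    obtain ⟨x, hx, -⟩ := hmem
    exact hspec x hx

end Schur

section NegatedSpaces

variable {B W : Type*} [Group W] {M : CoxeterMatrix B} (cs : CoxeterSystem M W)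
  {V : Type*} [AddCommGroup V] [Module ℂ V] (ρ : Representation ℂ W V)

/-- The operator `r - 1` of a simple reflection `r`. -/
def simpleSub (r : B) : Module.End ℂ V := ρ (cs.simple r) - 1

/-- The space of vectors negated by a simple reflection. -/
def negSpace (r : B) : Submodule ℂ V := LinearMap.ker (ρ (cs.simple r) + 1)

variable {cs ρ}

theorem mem_negSpace {r : B} {v : V} : v ∈ negSpace cs ρ r ↔ ρ (cs.simple r) v = -v := by
  rw [negSpace, LinearMap.mem_ker, LinearMap.add_apply, Module.End.one_apply,
    add_eq_zero_iff_eq_neg]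

theorem simpleSub_apply (r : B) (v : V) : simpleSub cs ρ r v = ρ (cs.simple r) v - v := rfl

theorem simple_apply (r : B) (v : V) : ρ (cs.simple r) v = v + simpleSub cs ρ r v := by
  rw [simpleSub_apply]
  abel

theorem simpleSub_mem_negSpace (r : B) (v : V) : simpleSub cs ρ r v ∈ negSpace cs ρ r := by
  rw [mem_negSpace, simpleSub_apply, map_sub, simple_apply_simple_apply]
  abel

theorem simpleSub_of_mem_negSpace {r : B} {v : V} (hv : v ∈ negSpace cs ρ r) :
    simpleSub cs ρ r v = (-2 : ℂ) • v := by
  rw [simpleSub_apply, mem_negSpace.mp hv]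
  module

theorem IsA1.simpleSub_eq_zero (h : IsA1 cs ρ) {r t : B} (hM : M t r = 2) {v : V}
    (hv : v ∈ negSpace cs ρ t) : simpleSub cs ρ r v = 0 := by
  refine h t r (by rintro rfl; simp at hM) (by simp [hM]) _ ?_
    (mem_negSpace.mp (simpleSub_mem_negSpace r v))
  rw [simpleSub_apply, map_sub, simple_commute_apply cs hM, mem_negSpace.mp hv, map_neg]
  abel

theorem IsA1.simpleSub_simpleSub (h : IsA1 cs ρ) {r t : B} (hM : M r t = 3) {v : V}
    (hv : v ∈ negSpace cs ρ r) : simpleSub cs ρ r (simpleSub cs ρ t v) = v := by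
  have hv' := mem_negSpace.mp hv
  have hbraid := simple_braid_apply cs (ρ := ρ) hM v
  rw [hv', map_neg, map_neg] at hbraid
  have h1 := h r t (by rintro rfl; simp at hM) (by simp [hM])
    (v - ρ (cs.simple t) v + ρ (cs.simple r) (ρ (cs.simple t) v))
    (by
      rw [map_add, map_sub, simple_apply_simple_apply, hv']
      abel)
    (by
      rw [map_add, map_sub, simple_apply_simple_apply, ← hbraid]
      abel)
  rw [simpleSub_apply, simpleSub_apply, map_sub, hv']
  linear_combination (norm := module) h1

/-- In an irreducible representation, a family of subspaces of the negated spaces which is stable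
under the operators `r - 1` consists of the whole negated spaces. -/
theorem negSpace_le_of_stable (hρ : ρ.IsIrreducible) {L : B → Submodule ℂ V}
    (h : ∀ r t, ∀ v ∈ L t, simpleSub cs ρ r v ∈ L r) {r : B} (hL : L r ≠ ⊥) :
    negSpace cs ρ r ≤ L r := by
  have hstable : ∀ s, ∀ v ∈ ⨆ i, L i, simpleSub cs ρ s v ∈ L s := by
    intro s
    have : ⨆ i, L i ≤ (L s).comap (simpleSub cs ρ s) := iSup_le fun i v hv => h s i v hv
    exact fun v hv => this hv
  let U : Subrepresentation ρ :=
    { toSubmodule := ⨆ i, L i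
      apply_mem_toSubmodule := fun g => by
        induction g using cs.simple_induction with
        | simple s =>
          intro v hv
          rw [simple_apply]
          exact add_mem hv (Submodule.mem_iSup_of_mem s (hstable s v hv))
        | one => simp
        | mul g g' hg hg' =>
          intro v hv
          rw [map_mul]
          exact hg (hg' hv) }
  have hU : U = ⊤ := by
    refine (eq_bot_or_eq_top U).resolve_left fun hbot => hL (eq_bot_iff.mpr ?_)
    have h1 : (⨆ i, L i) = ⊥ := congrArg Subrepresentation.toSubmodule hbot
    exact h1 ▸ le_iSup L r
  intro v hv
  have h1 : v ∈ U.toSubmodule := by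
    rw [hU]
    exact Submodule.mem_top
  have h2 := hstable r v h1
  rwa [simpleSub_of_mem_negSpace hv, Submodule.smul_mem_iff _ (by norm_num)] at h2

end NegatedSpaces

section Transport

variable {n : ℕ} {W : Type*} [Group W] (cs : CoxeterSystem (affineA n) W)
  {V : Type*} [AddCommGroup V] [Module ℂ V] (ρ : Representation ℂ W V)

/-- Transport along the circuit from the space negated by `s_0` to the one negated by `s_k`. -/
def transport : ℕ → Module.End ℂ V
  | 0 => 1
  | k + 1 => simpleSub cs ρ (Fin.ofNat (n + 1) k + 1) * transport k

/-- Transport along the circuit from the space negated by `s_k` to the one negated by `s_0`. -/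
def transportInv : ℕ → Module.End ℂ V
  | 0 => 1
  | k + 1 => transportInv k * simpleSub cs ρ (Fin.ofNat (n + 1) k)

theorem fin_ofNat_succ (k : ℕ) : Fin.ofNat (n + 1) (k + 1) = Fin.ofNat (n + 1) k + 1 := by
  ext
  simp [Fin.val_add]

variable {cs ρ}

theorem transport_mem (k : ℕ) {v : V} (hv : v ∈ negSpace cs ρ 0) :
    transport cs ρ k v ∈ negSpace cs ρ (Fin.ofNat (n + 1) k) := by
  cases k with
  | zero => exact hv
  | succ k =>
    rw [fin_ofNat_succ]
    exact simpleSub_mem_negSpace _ _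

theorem transportInv_mem (k : ℕ) {v : V} (hv : v ∈ negSpace cs ρ (Fin.ofNat (n + 1) k)) :
    transportInv cs ρ k v ∈ negSpace cs ρ 0 := by
  induction k generalizing v with
  | zero => exact hv
  | succ k ih => exact ih (simpleSub_mem_negSpace _ _)

theorem transportInv_transport (hn : 2 ≤ n) (h : IsA1 cs ρ) (k : ℕ) {v : V}
    (hv : v ∈ negSpace cs ρ 0) : transportInv cs ρ k (transport cs ρ k v) = v := by
  induction k with
  | zero => rfl
  | succ k ih =>
    change transportInv cs ρ k (simpleSub cs ρ _ (simpleSub cs ρ _ (transport cs ρ k v))) = v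
    rw [h.simpleSub_simpleSub (affineA_add_one_right hn _) (transport_mem k hv), ih]

theorem transport_transportInv (hn : 2 ≤ n) (h : IsA1 cs ρ) (k : ℕ) {v : V}
    (hv : v ∈ negSpace cs ρ (Fin.ofNat (n + 1) k)) :
    transport cs ρ k (transportInv cs ρ k v) = v := by
  induction k generalizing v with
  | zero => rfl
  | succ k ih =>
    rw [fin_ofNat_succ] at hv
    change simpleSub cs ρ _ (transport cs ρ k (transportInv cs ρ k (simpleSub cs ρ _ v))) = v
    rw [ih (simpleSub_mem_negSpace _ _),
      h.simpleSub_simpleSub (affineA_add_one_left hn _) hv]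

theorem simpleSub_transport (i : Fin (n + 1)) (v : V) :
    simpleSub cs ρ (i + 1) (transport cs ρ i v) = transport cs ρ (i + 1) v := by
  change _ = simpleSub cs ρ (Fin.ofNat (n + 1) i + 1) (transport cs ρ i v)
  rw [Fin.ofNat_val_eq_self]

theorem transport_val_mem (i : Fin (n + 1)) {v : V} (hv : v ∈ negSpace cs ρ 0) :
    transport cs ρ i v ∈ negSpace cs ρ i := by
  simpa using transport_mem (cs := cs) i hv

theorem simpleSub_transport_succ (hn : 2 ≤ n) (h : IsA1 cs ρ) (i : Fin (n + 1)) {v : V}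
    (hv : v ∈ negSpace cs ρ 0) :
    simpleSub cs ρ i (transport cs ρ (i + 1) v) = transport cs ρ i v := by
  rw [← simpleSub_transport,
    h.simpleSub_simpleSub (affineA_add_one_right hn _) (transport_val_mem i hv)]

/-- The monodromy operator on the space negated by `s_0`. -/
def monodromyEquiv (hn : 2 ≤ n) (h : IsA1 cs ρ) : negSpace cs ρ 0 ≃ₗ[ℂ] negSpace cs ρ 0 :=
  have h0 : negSpace cs ρ (Fin.ofNat (n + 1) (n + 1)) = negSpace cs ρ 0 := by
    congr 1
    ext
    simp
  LinearEquiv.ofLinearMap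
    ((transport cs ρ (n + 1)).restrict fun _ hv => h0.le (transport_mem (n + 1) hv))
    ((transportInv cs ρ (n + 1)).restrict fun _ hv => transportInv_mem (n + 1) (h0.ge hv))
    (LinearMap.ext fun v => Subtype.ext (transport_transportInv hn h (n + 1) (h0.ge v.2)))
    (LinearMap.ext fun v => Subtype.ext (transportInv_transport hn h (n + 1) v.2))

theorem coe_monodromyEquiv (hn : 2 ≤ n) (h : IsA1 cs ρ) (v : negSpace cs ρ 0) :
    (monodromyEquiv hn h v : V) = transport cs ρ (n + 1) v := rfl

theorem eq_bot_or_eq_top_of_monodromyEquiv (hn : 2 ≤ n) (h : IsA1 cs ρ) (hρ : ρ.IsIrreducible)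
    (N : Submodule ℂ (negSpace cs ρ 0)) (h1 : ∀ w ∈ N, monodromyEquiv hn h w ∈ N)
    (h2 : ∀ w ∈ N, (monodromyEquiv hn h).symm w ∈ N) : N = ⊥ ∨ N = ⊤ := by
  refine or_iff_not_imp_left.mpr fun hN => ?_
  let L : Fin (n + 1) → Submodule ℂ V := fun i =>
    (N.map (negSpace cs ρ 0).subtype).map (transport cs ρ i)
  have hmem : ∀ (i : Fin (n + 1)), ∀ w ∈ N, transport cs ρ i (w : V) ∈ L i := fun i w hw =>
    ⟨w, ⟨w, hw, rfl⟩, rfl⟩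
  have hL0 : L 0 = N.map (negSpace cs ρ 0).subtype := Submodule.map_id _
  have hsucc : ∀ i : Fin (n + 1), i ≠ Fin.last n → (i + 1).val = i.val + 1 := fun i hi => by
    rw [Fin.val_add_one, if_neg hi]
  have hstable : ∀ r t, ∀ v ∈ L t, simpleSub cs ρ r v ∈ L r := by
    rintro r t _ ⟨_, ⟨w, hw, rfl⟩, rfl⟩
    have hwneg := transport_val_mem t w.2
    by_cases hrt : r = t
    · subst hrt
      rw [Submodule.subtype_apply, simpleSub_of_mem_negSpace hwneg]
      exact Submodule.smul_mem _ _ (hmem r w hw)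
    by_cases h5 : r = t + 1
    · subst h5
      rw [Submodule.subtype_apply, simpleSub_transport]
      by_cases ht : t = Fin.last n
      · subst ht
        rw [Fin.last_add_one, hL0]
        exact ⟨_, h1 w hw, rfl⟩
      · rw [← hsucc t ht]
        exact hmem _ w hw
    by_cases h6 : t = r + 1
    · subst h6
      rw [Submodule.subtype_apply]
      by_cases hr : r = Fin.last n
      · subst hr
        have h7 : (w : V) = transport cs ρ ((Fin.last n : Fin (n + 1)) + 1)
            ((monodromyEquiv hn h).symm w : V) := by
          rw [Fin.val_last, ← coe_monodromyEquiv hn h, LinearEquiv.apply_symm_apply]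
        have h8 : transport cs ρ (Fin.last n + 1 : Fin (n + 1)).val (w : V) = w := by
          rw [Fin.last_add_one]
          rfl
        rw [h8, h7, simpleSub_transport_succ hn h _ (Subtype.property _)]
        exact hmem _ _ (h2 w hw)
      · rw [hsucc r hr, simpleSub_transport_succ hn h _ w.2]
        exact hmem _ w hw
    · rw [Submodule.subtype_apply,
        h.simpleSub_eq_zero (affineA_of_not_adj (Ne.symm hrt) h5 h6) hwneg]
      exact zero_mem _
  have hne : L 0 ≠ ⊥ := by
    rw [hL0]
    exact fun h0 => hN (Submodule.map_injective_of_injective (Submodule.injective_subtype _)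
      (h0.trans (Submodule.map_bot _).symm))
  have hle := negSpace_le_of_stable hρ hstable hne
  rw [hL0] at hle
  refine Submodule.eq_top_iff'.mpr fun w => ?_
  obtain ⟨w', hw', h7⟩ := hle w.2
  rwa [← Subtype.ext h7]

theorem nontrivial_negSpace (hn : 2 ≤ n) (h : IsA1 cs ρ) (hρ : ¬ ρ.IsTrivial) :
    Nontrivial (negSpace cs ρ 0) := by
  by_contra hnt
  rw [not_nontrivial_iff_subsingleton] at hnt
  refine hρ ⟨fun g => ?_⟩
  induction g using cs.simple_induction with
  | simple r =>
    ext v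
    have hv : simpleSub cs ρ r v ∈ negSpace cs ρ (Fin.ofNat (n + 1) r) := by
      simpa using simpleSub_mem_negSpace r v
    have h1 := congrArg Subtype.val
      (Subsingleton.elim (⟨_, transportInv_mem r.val hv⟩ : negSpace cs ρ 0) 0)
    have h2 := transport_transportInv hn h r.val hv
    rw [show transportInv cs ρ r.val (simpleSub cs ρ r v) = 0 from h1, map_zero] at h2
    rw [simple_apply, ← h2, add_zero, LinearMap.id_apply]
  | one => exact map_one ρ
  | mul g g' hg hg' => rw [map_mul, hg, hg']; rfl

/-- An irreducible nontrivial `A1`-representation contains a nonzero frame for some `V_x`. -/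
theorem exists_frame_datumX (hn : 2 ≤ n) (h : IsA1 cs ρ) (hρ : ρ.IsIrreducible)
    (hρ' : ¬ ρ.IsTrivial) :
    ∃ (x : ℂˣ) (e : Fin (n + 1) → V), IsFrame cs ρ (datumX n x).matrixA e ∧ e 0 ≠ 0 := by
  have := nontrivial_negSpace hn h hρ'
  obtain ⟨x, hx⟩ := exists_eq_smul_of_invariant (monodromyEquiv hn h)
    (eq_bot_or_eq_top_of_monodromyEquiv hn h hρ)
  obtain ⟨v, hv⟩ := exists_ne (0 : negSpace cs ρ 0)
  have hx0 : x ≠ 0 := by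
    rintro rfl
    apply hv
    rw [← (monodromyEquiv hn h).map_eq_zero_iff, hx, zero_smul]
  have hlast : transport cs ρ (n + 1) (v : V) = x • (v : V) := by
    rw [← coe_monodromyEquiv hn h, hx]
    rfl
  have hsucc : ∀ i : Fin (n + 1), transport cs ρ (i + 1) (v : V) =
      (if i = Fin.last n then x else 1) • transport cs ρ (i + 1 : Fin (n + 1)).val (v : V) := by
    intro i
    split_ifs with hi
    · subst hi
      rw [Fin.last_add_one]
      exact hlast
    · rw [one_smul, Fin.val_add_one, if_neg hi]
  refine ⟨Units.mk0 x hx0, fun i => transport cs ρ i (v : V),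
    isFrame_datumX hn _ (fun i => ?_) (fun i => ?_) (fun i => ?_) (fun r t hrt => ?_), ?_⟩
  · exact mem_negSpace.mp (transport_val_mem i v.2)
  · rw [simple_apply, simpleSub_transport, hsucc, Units.val_mk0]
  · have h1 := simpleSub_transport_succ hn h i v.2
    rw [hsucc, map_smul] at h1
    rw [simple_apply, ← h1, Units.val_mk0, smul_smul]
    split_ifs
    · rw [inv_mul_cancel₀ hx0, one_smul]
    · rw [one_mul, one_smul]
  · rw [simple_apply, h.simpleSub_eq_zero ((affineA n).symmetric t r ▸ hrt)
      (transport_val_mem t v.2), add_zero]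
  · exact fun h0 => hv (Subtype.ext h0)

/-- The classification of the irreducible nontrivial `A1`-representations of type `Ã_n`. -/
theorem IsA1.equiv_quotientRep_or_equiv_repX (hn : 2 ≤ n) (h : IsA1 cs ρ) (hρ : ρ.IsIrreducible)
    (hρ' : ¬ ρ.IsTrivial) :
    Nonempty (ρ.Equiv (quotientRep (repX cs 1) (radical 1 cs))) ∨
      ∃ x : ℂˣ, x ≠ 1 ∧ Nonempty (ρ.Equiv (repX cs x)) := by
  obtain ⟨x, e, he, he0⟩ := exists_frame_datumX hn h hρ hρ'
  let f : (repX cs x).IntertwiningMap ρ := (datumX n x).homOfFrame he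
  have hf : f ≠ 0 := by
    intro h0
    apply he0
    have h1 : f (Pi.single 0 1) = e 0 := by
      refine ((datumX n x).homOfFrame_apply he _).trans ?_
      simp [Pi.single_apply]
    rw [← h1, h0]
    rfl
  have hsurj : Function.Surjective f :=
    (Representation.IsIrreducible.surjective_or_eq_zero f).resolve_right hf
  by_cases hx : x = 1
  · subst hx
    left
    obtain ⟨φ⟩ := nonempty_equiv_quotientRep f hsurj
    have hU : f.ker = radical 1 cs :=
      (isCoatom_subrep_repX_iff hn _).mp ((isIrreducible_iff_isCoatom_ker f hsurj).mp hρ)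
    rw [← hU]
    exact ⟨φ⟩
  · right
    have := (isIrreducible_repX_iff (cs := cs) hn x).mpr hx
    exact ⟨x, hx, ⟨(f.ofBijective ⟨(Representation.IsIrreducible.injective_or_eq_zero f).resolve_right
      hf, hsurj⟩).symm⟩⟩

end Transport

end CoxeterIR

end

theorem mainTheorem11 (n : ℕ) (hn : 2 ≤ n) {W : Type u} [Group W]
    (cs : CoxeterSystem (CoxeterIR.affineA n) W) :
    -- the geometric representation has exactly one simple quotient, and the classification holds
    (∃ U : Subrepresentation (CoxeterIR.geometricRep cs),
      (∀ U' : Subrepresentation (CoxeterIR.geometricRep cs),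
        (CoxeterIR.quotientRep (CoxeterIR.geometricRep cs) U').IsIrreducible ↔ U' = U) ∧
      ∀ (V : Type v) [AddCommGroup V] [Module ℂ V] (ρ : Representation ℂ W V),
        ρ.IsIrreducible → ¬ ρ.IsTrivial → CoxeterIR.IsA1 cs ρ →
          Nonempty (ρ.Equiv (CoxeterIR.quotientRep (CoxeterIR.geometricRep cs) U)) ∨
          ∃ x : ℂˣ, x ≠ 1 ∧ Nonempty (ρ.Equiv (CoxeterIR.repX cs x))) ∧
    -- every `IR`-representation has a well-defined monodromy, which is a nonzero number
    (∀ (V : Type v) [AddCommGroup V] [Module ℂ V] (ρ : Representation ℂ W V),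
      CoxeterIR.IsIR cs ρ → ∃! x : ℂ, x ≠ 0 ∧ CoxeterIR.HasMonodromy cs ρ x) ∧
    -- `V_x` is, up to isomorphism, the `IR`-representation with monodromy `x`
    (∀ x : ℂˣ, CoxeterIR.IsIR cs (CoxeterIR.repX cs x) ∧
      CoxeterIR.HasMonodromy cs (CoxeterIR.repX cs x) x ∧
      ∀ (V : Type v) [AddCommGroup V] [Module ℂ V] (ρ : Representation ℂ W V),
        CoxeterIR.IsIR cs ρ →
          (CoxeterIR.HasMonodromy cs ρ x ↔ Nonempty (ρ.Equiv (CoxeterIR.repX cs x)))) ∧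
    -- determinant of the matrix of `V_x` and irreducibility of `V_x`
    (∀ x : ℂˣ,
      (CoxeterIR.datumX n x).matrixA.det = (2 - (x : ℂ) - (x : ℂ)⁻¹) / 2 ^ (n + 1) ∧
      ((CoxeterIR.repX cs x).IsIrreducible ↔ x ≠ 1)) := by
  refine ⟨?_, fun V _ _ ρ h => h.existsUnique_monodromy hn, fun x =>
    ⟨CoxeterIR.isIR_rep _ cs, CoxeterIR.hasMonodromy_repX hn x,
      fun V _ _ ρ _ => CoxeterIR.hasMonodromy_iff hn x⟩,
    fun x => ⟨CoxeterIR.det_matrixA_datumX hn x, CoxeterIR.isIrreducible_repX_iff hn x⟩⟩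
  rw [CoxeterIR.geometricRep_eq]
  exact ⟨CoxeterIR.radical 1 cs, fun U => (CoxeterIR.isIrreducible_quotientRep_iff _ U).trans
    (CoxeterIR.isCoatom_subrep_repX_iff hn U), fun V _ _ ρ h1 h2 h3 =>
      h3.equiv_quotientRep_or_equiv_repX hn h1 h2⟩
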